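/- Let $d\ge 2$ be an integer, $\alpha\in(0,1)$ and $s\in(0,d/2)$. For $v\in\mathbb{R}^d$ write $\langle v\rangle=(1+|v|^2)^{1/2}$ and, for $v\neq 0$, let $P^\perp_v=I_d-\frac{v}{|v|}\otimes\frac{v}{|v|}$ be the orthogonal projection onto $v^\perp$. For $\xi\in\mathbb{R}^d\setminus\{0\}$ define the flux function $$F(\xi)=(2\pi)^{-d/2}\int_{\mathbb{R}^d}\frac{1}{\langle\xi-\eta\rangle^{d+2\alpha}}\,|P^\perp_{\xi-\eta}\xi|^2\Big(\frac{1}{|\eta|^{2s}}-\frac{1}{|\xi|^{2s}}\Big)\,d\eta .$$ This integral converges absolutely for every $\xi\ne0$. Let $$K_{d,\alpha,s}=-\frac{2^{-d/2-1}\,(d-1)\,\Gamma(s+\alpha)\,\Gamma(-\alpha)\,\Gamma\big(\tfrac{d-2s+2}{2}\big)}{\Gamma(s)\,\Gamma\big(\tfrac{d+2\alpha+2}{2}\big)\,\Gamma\big(\tfrac{d-2s+2-2\alpha}{2}\big)} .$$ Then $K_{d,\alpha,s}>0$, and there exists a finite constant $C_{d,\alpha,s}>0$, depending only on $d,\alpha,s$,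 such that $$\big|F(\xi)+K_{d,\alpha,s}|\xi|^{2-2\alpha-2s}\big|\le C_{d,\alpha,s}|\xi|^{-2s}\qquad\text{for all }\xi\in\mathbb{R}^d\setminus\{0\}.$$ -/

import Mathlib

open MeasureTheory

noncomputable section

/-- The Japanese bracket `⟨v⟩ = (1 + |v|²)^{1/2}` on `ℝ^d`. -/
def japaneseBracket {d : ℕ} (v : EuclideanSpace ℝ (Fin d)) : ℝ :=
  Real.sqrt (1 + ‖v‖ ^ 2)

/-- `P^⊥_v x = x - (v · x / |v|²) v`, the image of `x` under the orthogonal projection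
`I - (v/|v|) ⊗ (v/|v|)` onto the orthogonal complement of `v ≠ 0`
(for `v = 0` the formula gives the identity). -/
def projPerp {d : ℕ} (v x : EuclideanSpace ℝ (Fin d)) : EuclideanSpace ℝ (Fin d) :=
  x - (inner ℝ v x / ‖v‖ ^ 2) • v

/-- `projPerp v` is Mathlib's orthogonal projection onto `v^⊥`. -/
theorem projPerp_eq_starProjection {d : ℕ} (v x : EuclideanSpace ℝ (Fin d)) :
    projPerp v x = (ℝ ∙ v)ᗮ.starProjection x := by
  rw [Submodule.starProjection_orthogonal_val, Submodule.starProjection_singleton]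
  simp [projPerp]

/-- The integrand `⟨ξ-η⟩^{-d-2α} |P^⊥_{ξ-η} ξ|² (|η|^{-2s} - |ξ|^{-2s})` of the flux function. -/
def fluxIntegrand {d : ℕ} (α s : ℝ) (ξ η : EuclideanSpace ℝ (Fin d)) : ℝ :=
  1 / japaneseBracket (ξ - η) ^ ((d : ℝ) + 2 * α) * ‖projPerp (ξ - η) ξ‖ ^ 2 *
    (1 / ‖η‖ ^ (2 * s) - 1 / ‖ξ‖ ^ (2 * s))

/-- The flux function
`F(ξ) = (2π)^{-d/2} ∫ ⟨ξ-η⟩^{-d-2α} |P^⊥_{ξ-η} ξ|² (|η|^{-2s} - |ξ|^{-2s}) dη`. -/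
def fluxFunction {d : ℕ} (α s : ℝ) (ξ : EuclideanSpace ℝ (Fin d)) : ℝ :=
  (2 * Real.pi) ^ (-(d : ℝ) / 2) * ∫ η : EuclideanSpace ℝ (Fin d), fluxIntegrand α s ξ η

/-- The leading constant
`K = - 2^{-d/2-1} (d-1) Γ(s+α) Γ(-α) Γ((d-2s+2)/2)
      / (Γ(s) Γ((d+2α+2)/2) Γ((d-2s+2-2α)/2))`. -/
def fluxConstant (d : ℕ) (α s : ℝ) : ℝ :=
  -((2 : ℝ) ^ (-(d : ℝ) / 2 - 1) * ((d : ℝ) - 1) *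
      Real.Gamma (s + α) * Real.Gamma (-α) * Real.Gamma (((d : ℝ) - 2 * s + 2) / 2)) /
    (Real.Gamma s * Real.Gamma (((d : ℝ) + 2 * α + 2) / 2) *
      Real.Gamma (((d : ℝ) - 2 * s + 2 - 2 * α) / 2))

end

open Set Filter Topology

/-! ### Gaussian moments -/

/-! Everything is subordinated to Gaussians, which makes the integral over space explicit and leaves
a one-variable asymptotic problem. Put z = ξ - η, r = |ξ|², a = d/2 + α, b = d/2 - s and Q(z) =
|ξ|²|z|² - ⟨z,ξ⟩². The kernel becomes (1+|z|²)^{-a} |z|^{-2} Q(z). Dividing the Laplace transform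
(1+x)^{-a} by x amounts to integrating its density, so (1+|z|²)^{-a}/|z|² = ∫₀^∞ g(t) e^{-t|z|²} dt
with g = `gammaLower a` (`integral_gammaLower_mul_exp`). Likewise Γ(s)|ξ-z|^{-2s} = ∫₀^∞ u^{s-1}
e^{-u|ξ-z|²} du.

Since Q is invariant under translation along ξ, completing the square turns the z-integral of Q
against the two Gaussians into a centred second moment, with the factor exp(-r ut/(t+u)). The
substitution v = ut/(t+u) turns the u-integral into one of v^{s-1} e^{-vr} (1-v/t)₊^b. Subtracting
the |ξ|^{-2s} term replaces (1-v/t)₊^b by -(1-(1-v/t)₊^b). Hence F(ξ) = -c r ∫₀^∞ g(t) t^{-d/2-1}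
H(t) dt, where c > 0 and H(t) ≥ 0 is `powDefectLaplace` (`integral_fluxIntegrand_eq`).

Near 0, g(t) is t^a/Γ(a+1) to leading order. Using that power for all t gives the Mellin transform
of H, an exact multiple of r^{-(s+α)}: this is the main term with constant K. The error in g is
O(min(t^{a+1}, t^a)) and H(t) = O(r^{-(s+1)}/t), so the remaining t-integral converges precisely
because 0 < α < 1. The error is O(r · r^{-(s+1)}) = O(|ξ|^{-2s}), uniformly in ξ. -/

theorem integral_sq_mul_exp_neg_mul_sq {c : ℝ} (hc : 0 < c) :
    ∫ x : ℝ, x ^ 2 * Real.exp (-c * x ^ 2) = (2 * c)⁻¹ * √(Real.pi / c) := by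
  have h1 : ∫ x : ℝ, x ^ 2 * Real.exp (-c * x ^ 2)
      = ∫ x : ℝ, (fun y : ℝ => y ^ (2 : ℝ) * Real.exp (-c * y ^ (2 : ℝ))) |x| := by
    refine integral_congr_ae (Eventually.of_forall fun x => ?_)
    simp [sq_abs]
  rw [h1, integral_comp_abs (f := fun y : ℝ => y ^ (2 : ℝ) * Real.exp (-c * y ^ (2 : ℝ))),
    integral_rpow_mul_exp_neg_mul_rpow two_pos (by norm_num) hc]
  have h2 : Real.Gamma ((2 + 1) / 2) = 1 / 2 * √Real.pi := by
    rw [← Real.Gamma_one_half_eq, ← Real.Gamma_add_one (by norm_num)]; norm_num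
  have h3 : c ^ (-(2 + 1 : ℝ) / 2) = c⁻¹ * (√c)⁻¹ := by
    rw [Real.sqrt_eq_rpow, ← Real.rpow_neg hc.le, ← Real.rpow_neg_one, ← Real.rpow_add hc]
    norm_num
  rw [h2, h3, Real.sqrt_div Real.pi_pos.le]
  field_simp

theorem integral_coord_sq_mul_exp_neg_mul_sq_norm {d : ℕ} {c : ℝ} (hc : 0 < c) (i : Fin d) :
    ∫ z : EuclideanSpace ℝ (Fin d), z i ^ 2 * Real.exp (-c * ‖z‖ ^ 2)
      = (2 * c)⁻¹ * (Real.pi / c) ^ ((d : ℝ) / 2) := by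
  rw [← (PiLp.volume_preserving_toLp (Fin d)).integral_comp
    (MeasurableEquiv.toLp 2 (Fin d → ℝ)).measurableEmbedding]
  let f : Fin d → ℝ → ℝ := fun j x => (if j = i then x ^ 2 else 1) * Real.exp (-c * x ^ 2)
  have h1 : ∀ x : Fin d → ℝ, (WithLp.toLp 2 x : EuclideanSpace ℝ (Fin d)) i ^ 2 *
      Real.exp (-c * ‖(WithLp.toLp 2 x : EuclideanSpace ℝ (Fin d))‖ ^ 2) = ∏ j, f j (x j) := by
    intro x
    simp only [f, Finset.prod_mul_distrib, ← Real.exp_sum, ← Finset.mul_sum,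
      EuclideanSpace.norm_sq_eq, Real.norm_eq_abs, sq_abs]
    simp
  simp_rw [h1]
  rw [integral_fintype_prod_volume_eq_prod]
  have h2 : ∀ j, ∫ x, f j x = (if j = i then (2 * c)⁻¹ else 1) * √(Real.pi / c) := by
    intro j
    by_cases h : j = i
    · simp only [f, h, if_true]; exact integral_sq_mul_exp_neg_mul_sq hc
    · simp only [f, h, if_false, one_mul]; exact integral_gaussian c
  simp_rw [h2]
  rw [Finset.prod_mul_distrib, Finset.prod_const, Finset.card_univ, Fintype.card_fin,
    Finset.prod_ite_eq' Finset.univ i, if_pos (Finset.mem_univ i), Real.sqrt_eq_rpow,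
    ← Real.rpow_natCast, ← Real.rpow_mul (by positivity)]
  congr 2; ring

theorem integrable_coord_sq_mul_exp_neg_mul_sq_norm {d : ℕ} {c : ℝ} (hc : 0 < c) (i : Fin d) :
    Integrable fun z : EuclideanSpace ℝ (Fin d) => z i ^ 2 * Real.exp (-c * ‖z‖ ^ 2) := by
  -- A non-integrable function has integral 0 by convention, whereas the value computed above is
  -- positive.
  by_contra h
  have := integral_undef h
  rw [integral_coord_sq_mul_exp_neg_mul_sq_norm hc i] at this
  have hp : 0 < (2 * c)⁻¹ * (Real.pi / c) ^ ((d : ℝ) / 2) := by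
    have := Real.pi_pos; positivity
  linarith

/-- The quadratic form `|ξ|² |z|² - ⟨z, ξ⟩² = |z|² |P^⊥_z ξ|²`. -/
noncomputable def transverseForm {d : ℕ} (ξ z : EuclideanSpace ℝ (Fin d)) : ℝ :=
  ‖ξ‖ ^ 2 * ‖z‖ ^ 2 - inner ℝ z ξ ^ 2

/-! ### The transverse form against Gaussian weights -/

section transverse

variable {d : ℕ} (ξ z : EuclideanSpace ℝ (Fin d))

theorem transverseForm_nonneg : 0 ≤ transverseForm ξ z := by
  have := abs_real_inner_le_norm z ξ
  have h2 := sq_le_sq' (by linarith [neg_abs_le (inner ℝ z ξ), abs_nonneg (inner ℝ z ξ)])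
    (le_trans (le_abs_self _) this)
  unfold transverseForm
  nlinarith

/-- The form is |ξ|² times the squared distance from z to the line ℝξ, so it does not see shifts
along ξ. This is what lets the square be completed without producing cross terms. -/
theorem transverseForm_add_smul (a : ℝ) : transverseForm ξ (z + a • ξ) = transverseForm ξ z := by
  simp only [transverseForm, norm_add_sq_real, inner_add_left, real_inner_smul_left,
    real_inner_smul_right, norm_smul, real_inner_self_eq_norm_sq, Real.norm_eq_abs, mul_pow, sq_abs]
  ring

theorem continuous_transverseForm : Continuous (transverseForm ξ) := by
  unfold transverseForm; fun_prop

theorem sq_norm_projPerp {z : EuclideanSpace ℝ (Fin d)} (hz : z ≠ 0) :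
    ‖projPerp z ξ‖ ^ 2 = transverseForm ξ z / ‖z‖ ^ 2 := by
  have hz' : ‖z‖ ≠ 0 := norm_ne_zero_iff.2 hz
  simp only [projPerp, transverseForm, norm_sub_sq_real, real_inner_smul_right, norm_smul,
    Real.norm_eq_abs, mul_pow, sq_abs, real_inner_comm]
  field_simp
  ring

/-- Complete ξ/|ξ| to an orthonormal basis: the form drops exactly that coordinate. For ξ = 0 any
unit vector serves, both sides being 0. -/
theorem exists_orthonormalBasis_transverseForm (hd : 2 ≤ d) :
    ∃ (b : OrthonormalBasis (Fin d) ℝ (EuclideanSpace ℝ (Fin d))) (i₀ : Fin d),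
      ∀ z, transverseForm ξ z = ‖ξ‖ ^ 2 * ∑ i ∈ {i₀}ᶜ, b.repr z i ^ 2 := by
  let i₀ : Fin d := ⟨0, by omega⟩
  obtain ⟨e, he, hξ⟩ : ∃ e : EuclideanSpace ℝ (Fin d), ‖e‖ = 1 ∧ ξ = ‖ξ‖ • e := by
    by_cases h : ξ = 0
    · exact ⟨EuclideanSpace.single i₀ 1, by simp, by simp [h]⟩
    · have : ‖ξ‖ ≠ 0 := norm_ne_zero_iff.2 h
      exact ⟨‖ξ‖⁻¹ • ξ, by simp [norm_smul, this], by simp [smul_smul, this]⟩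
  obtain ⟨b, hb⟩ := Orthonormal.exists_orthonormalBasis_extension_of_card_eq (𝕜 := ℝ)
    (E := EuclideanSpace ℝ (Fin d)) (ι := Fin d) (by simp) (v := fun _ => e) (s := {i₀})
    (by
      constructor
      · intro i; simpa using he
      · intro i j hij; exact absurd (Subsingleton.elim i j) hij)
  refine ⟨b, i₀, fun z => ?_⟩
  have hb0 : b i₀ = e := hb i₀ rfl
  have hs : ∑ i, b.repr z i ^ 2 = ‖z‖ ^ 2 := by
    have := EuclideanSpace.norm_sq_eq (b.repr z)
    rw [LinearIsometryEquiv.norm_map] at this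
    simpa using this.symm
  have hs2 := Finset.sum_add_sum_compl ({i₀} : Finset (Fin d)) (fun i => b.repr z i ^ 2)
  rw [Finset.sum_singleton, hs] at hs2
  have h0 : b.repr z i₀ = inner ℝ z e := by
    rw [b.repr_apply_apply, hb0, real_inner_comm]
  have h1 : inner ℝ z ξ = ‖ξ‖ * inner ℝ z e := by
    conv_lhs => rw [hξ]
    rw [real_inner_smul_right]
  unfold transverseForm
  rw [h1, ← hs2, h0]
  ring

variable {ξ}

/-- Each of the d - 1 coordinates orthogonal to ξ contributes the same Gaussian second moment; this
is the origin of the factor d - 1 in K. -/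
theorem integrable_transverseForm_mul_exp_and_integral_eq (hd : 2 ≤ d) {c : ℝ} (hc : 0 < c) :
    Integrable (fun z => transverseForm ξ z * Real.exp (-c * ‖z‖ ^ 2)) ∧
    ∫ z, transverseForm ξ z * Real.exp (-c * ‖z‖ ^ 2)
      = ‖ξ‖ ^ 2 * ((d : ℝ) - 1) / (2 * c) * (Real.pi / c) ^ ((d : ℝ) / 2) := by
  obtain ⟨b, i₀, hQ⟩ := exists_orthonormalBasis_transverseForm ξ hd
  have hmp := b.measurePreserving_repr
  have hemb : MeasurableEmbedding b.repr := b.repr.toHomeomorph.measurableEmbedding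
  have h1 : ∀ z, transverseForm ξ z * Real.exp (-c * ‖z‖ ^ 2) =
      (fun y : EuclideanSpace ℝ (Fin d) =>
        ‖ξ‖ ^ 2 * ∑ i ∈ {i₀}ᶜ, y i ^ 2 * Real.exp (-c * ‖y‖ ^ 2)) (b.repr z) := by
    intro z
    simp only [hQ, LinearIsometryEquiv.norm_map, ← Finset.sum_mul, mul_assoc]
  have hint : ∀ i ∈ ({i₀}ᶜ : Finset (Fin d)), Integrable
      fun y : EuclideanSpace ℝ (Fin d) => y i ^ 2 * Real.exp (-c * ‖y‖ ^ 2) :=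
    fun i _ => integrable_coord_sq_mul_exp_neg_mul_sq_norm hc i
  constructor
  · simp_rw [h1]
    exact (hmp.integrable_comp_emb hemb).2 ((integrable_finsetSum _ hint).const_mul _)
  · rw [integral_congr_ae (Eventually.of_forall h1), hmp.integral_comp hemb
      (fun y : EuclideanSpace ℝ (Fin d) => ‖ξ‖ ^ 2 * ∑ i ∈ {i₀}ᶜ, y i ^ 2 * Real.exp (-c * ‖y‖ ^ 2)),
      integral_const_mul, integral_finsetSum _ hint]
    simp_rw [integral_coord_sq_mul_exp_neg_mul_sq_norm hc]
    rw [Finset.sum_const, Finset.card_compl, Finset.card_singleton, Fintype.card_fin, nsmul_eq_mul,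
      Nat.cast_sub (by omega)]
    push_cast
    field_simp

/-- Complete the square: t|z|² + u|ξ-z|² = (t+u)|z - (u/(t+u))ξ|² + (ut/(t+u))|ξ|². The centre lies
on ℝξ, so translating it to the origin leaves the form unchanged. -/
theorem integrable_transverseForm_mul_exp_mul_exp_and_integral_eq (hd : 2 ≤ d) {t u : ℝ}
    (ht : 0 < t) (hu : 0 < u) :
    Integrable (fun z => transverseForm ξ z * Real.exp (-t * ‖z‖ ^ 2) *
      Real.exp (-u * ‖ξ - z‖ ^ 2)) ∧
    ∫ z, transverseForm ξ z * Real.exp (-t * ‖z‖ ^ 2) * Real.exp (-u * ‖ξ - z‖ ^ 2)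
      = ‖ξ‖ ^ 2 * ((d : ℝ) - 1) / (2 * (t + u)) * (Real.pi / (t + u)) ^ ((d : ℝ) / 2) *
        Real.exp (-(u * t / (t + u)) * ‖ξ‖ ^ 2) := by
  have htu : 0 < t + u := by positivity
  have h1 : ∀ z, transverseForm ξ z * Real.exp (-t * ‖z‖ ^ 2) * Real.exp (-u * ‖ξ - z‖ ^ 2) =
      (fun y => transverseForm ξ y * Real.exp (-(t + u) * ‖y‖ ^ 2) *
        Real.exp (-(u * t / (t + u)) * ‖ξ‖ ^ 2)) (z + (-(u / (t + u))) • ξ) := by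
    intro z
    simp only [transverseForm_add_smul]
    rw [mul_assoc, mul_assoc, ← Real.exp_add, ← Real.exp_add]
    congr 2
    simp only [norm_add_sq_real, norm_sub_sq_real, norm_smul, real_inner_smul_right,
      Real.norm_eq_abs, mul_pow, sq_abs, real_inner_comm]
    field_simp
    ring
  obtain ⟨hi, he⟩ := integrable_transverseForm_mul_exp_and_integral_eq (ξ := ξ) hd htu
  constructor
  · simp_rw [h1]
    exact (hi.mul_const _).comp_add_right _
  · simp_rw [h1]
    rw [integral_add_right_eq_self (μ := volume) (fun y => transverseForm ξ y *
      Real.exp (-(t + u) * ‖y‖ ^ 2) * Real.exp (-(u * t / (t + u)) * ‖ξ‖ ^ 2)),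
      integral_mul_const, he]

end transverse

/-! ### The regularized lower incomplete Gamma function -/

/-- The regularized lower incomplete Gamma function `Γ(a)⁻¹ ∫₀ᵗ τ^{a-1} e^{-τ} dτ`. -/
noncomputable def gammaLower (a t : ℝ) : ℝ :=
  (Real.Gamma a)⁻¹ * ∫ τ in (0 : ℝ)..t, τ ^ (a - 1) * Real.exp (-τ)

section gammaLower

-- With a ≥ 1 the density τ^{a-1}e^{-τ} is continuous on all of ℝ, so the fundamental theorem of
-- calculus applies at every point. The value used later, a = d/2 + α, satisfies this because d ≥ 2.
variable {a : ℝ} (ha : 1 ≤ a)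
include ha

theorem continuous_rpow_mul_exp_neg : Continuous fun τ : ℝ => τ ^ (a - 1) * Real.exp (-τ) :=
  (Real.continuous_rpow_const (by linarith)).mul (by fun_prop)

theorem hasDerivAt_gammaLower (t : ℝ) :
    HasDerivAt (gammaLower a) ((Real.Gamma a)⁻¹ * (t ^ (a - 1) * Real.exp (-t))) t :=
  ((continuous_rpow_mul_exp_neg ha).integral_hasStrictDerivAt 0 t).hasDerivAt.const_mul _

theorem continuous_gammaLower : Continuous (gammaLower a) :=
  continuous_iff_continuousAt.2 fun t => (hasDerivAt_gammaLower ha t).continuousAt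

theorem gammaLower_nonneg {t : ℝ} (ht : 0 ≤ t) : 0 ≤ gammaLower a t := by
  refine mul_nonneg (inv_nonneg.2 (Real.Gamma_nonneg_of_nonneg (by linarith)))
    (intervalIntegral.integral_nonneg ht fun τ hτ => ?_)
  have := hτ.1
  positivity

theorem gammaLower_le {t : ℝ} (ht : 0 ≤ t) : gammaLower a t ≤ t ^ a / Real.Gamma (a + 1) := by
  have hΓ : 0 < Real.Gamma a := Real.Gamma_pos_of_pos (by linarith)
  have h : ∫ τ in (0 : ℝ)..t, τ ^ (a - 1) * Real.exp (-τ) ≤ ∫ τ in (0 : ℝ)..t, τ ^ (a - 1) := by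
    refine intervalIntegral.integral_mono_on ht
      ((continuous_rpow_mul_exp_neg ha).intervalIntegrable _ _)
      ((Real.continuous_rpow_const (by linarith)).intervalIntegrable _ _) fun τ hτ => ?_
    exact mul_le_of_le_one_right (Real.rpow_nonneg hτ.1 _) (Real.exp_le_one_iff.2 (by linarith [hτ.1]))
  rw [integral_rpow (Or.inl (by linarith)), sub_add_cancel, Real.zero_rpow (by linarith),
    sub_zero] at h
  rw [Real.Gamma_add_one (by linarith), gammaLower]
  calc _ ≤ (Real.Gamma a)⁻¹ * (t ^ a / a) := by gcongr
    _ = _ := by field_simp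

/-- Integrate 1 - τ ≤ e^{-τ} against τ^{a-1}; the factor 1/(a+1) this produces is discarded. -/
theorem rpow_div_Gamma_sub_gammaLower_le {t : ℝ} (ht : 0 ≤ t) :
    t ^ a / Real.Gamma (a + 1) - gammaLower a t ≤ t ^ (a + 1) / Real.Gamma a := by
  have hΓ : 0 < Real.Gamma a := Real.Gamma_pos_of_pos (by linarith)
  have h : ∫ τ in (0 : ℝ)..t, (τ ^ (a - 1) - τ ^ a)
      ≤ ∫ τ in (0 : ℝ)..t, τ ^ (a - 1) * Real.exp (-τ) := by
    refine intervalIntegral.integral_mono_on ht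
      (((Real.continuous_rpow_const (by linarith)).sub
        (Real.continuous_rpow_const (by linarith))).intervalIntegrable _ _)
      ((continuous_rpow_mul_exp_neg ha).intervalIntegrable _ _) fun τ hτ => ?_
    have h1 : τ ^ a = τ ^ (a - 1) * τ := by
      conv_lhs => rw [show a = (a - 1) + 1 by ring]
      exact Real.rpow_add_one' hτ.1 (by linarith)
    have h2 : 1 - τ ≤ Real.exp (-τ) := by linarith [Real.add_one_le_exp (-τ)]
    rw [h1]
    nlinarith [Real.rpow_nonneg hτ.1 (a - 1)]
  rw [intervalIntegral.integral_sub
      ((Real.continuous_rpow_const (by linarith)).intervalIntegrable _ _)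
      ((Real.continuous_rpow_const (by linarith)).intervalIntegrable _ _),
    integral_rpow (Or.inl (by linarith)), integral_rpow (Or.inl (by linarith)), sub_add_cancel,
    Real.zero_rpow (by linarith), Real.zero_rpow (by linarith), sub_zero, sub_zero] at h
  rw [Real.Gamma_add_one (by linarith), gammaLower]
  have h3 : t ^ (a + 1) / (a + 1) ≤ t ^ (a + 1) :=
    div_le_self (Real.rpow_nonneg ht _) (by linarith)
  have h4 : (Real.Gamma a)⁻¹ * (t ^ a / a - t ^ (a + 1)) ≤
      (Real.Gamma a)⁻¹ * ∫ τ in (0 : ℝ)..t, τ ^ (a - 1) * Real.exp (-τ) := by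
    gcongr; linarith
  have h5 : (Real.Gamma a)⁻¹ * (t ^ a / a - t ^ (a + 1)) =
      t ^ a / (a * Real.Gamma a) - t ^ (a + 1) / Real.Gamma a := by
    field_simp
  linarith

theorem integrableOn_gammaLower_mul_exp {x : ℝ} (hx : 0 < x) :
    IntegrableOn (fun t => gammaLower a t * Real.exp (-t * x)) (Ioi 0) := by
  have h : IntegrableOn (fun t : ℝ => (Real.Gamma (a + 1))⁻¹ * (t ^ a * Real.exp (-x * t ^ (1 : ℝ))))
      (Ioi 0) :=
    (integrableOn_rpow_mul_exp_neg_mul_rpow (by linarith) one_pos hx).const_mul _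
  refine h.mono' (((continuous_gammaLower ha).mul (by fun_prop)).aestronglyMeasurable)
    ((ae_restrict_iff' measurableSet_Ioi).2 (Eventually.of_forall fun t ht => ?_))
  have ht' : 0 ≤ t := le_of_lt ht
  rw [Real.norm_of_nonneg (mul_nonneg (gammaLower_nonneg ha ht') (Real.exp_nonneg _)),
    Real.rpow_one, ← mul_assoc, inv_mul_eq_div, show -x * t = -t * x by ring]
  exact mul_le_mul_of_nonneg_right (gammaLower_le ha ht') (Real.exp_nonneg _)

/-- The function g(t)e^{-tx} vanishes at 0 and at infinity, so its derivative integrates to 0. This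
equates x times the integral with the Gamma integral Γ(a)⁻¹∫ t^{a-1}e^{-(1+x)t} dt = (1+x)^{-a}. -/
theorem integral_gammaLower_mul_exp {x : ℝ} (hx : 0 < x) :
    ∫ t in Ioi (0 : ℝ), gammaLower a t * Real.exp (-t * x) = (1 + x) ^ (-a) / x := by
  have hΓ : 0 < Real.Gamma a := Real.Gamma_pos_of_pos (by linarith)
  have hI := integrableOn_gammaLower_mul_exp ha hx
  have h1 : ∀ t ∈ Ioi (0 : ℝ), HasDerivAt (fun t => gammaLower a t * Real.exp (-t * x))
      ((Real.Gamma a)⁻¹ * (t ^ (a - 1) * Real.exp (-((1 + x) * t))) -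
        x * (gammaLower a t * Real.exp (-t * x))) t := by
    intro t _
    have he : HasDerivAt (fun t : ℝ => Real.exp (-t * x)) (Real.exp (-t * x) * (-1 * x)) t :=
      (((hasDerivAt_id t).neg).mul_const x).exp
    convert! (hasDerivAt_gammaLower ha t).mul he using 1
    rw [show -((1 + x) * t) = -t + -t * x by ring, Real.exp_add]
    ring
  have hI2 : IntegrableOn (fun t : ℝ => (Real.Gamma a)⁻¹ *
      (t ^ (a - 1) * Real.exp (-((1 + x) * t)))) (Ioi 0) := by
    have := integrableOn_rpow_mul_exp_neg_mul_rpow (p := 1) (s := a - 1) (b := 1 + x)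
      (by linarith) one_pos (by linarith)
    refine Integrable.const_mul (this.congr_fun (fun t _ => ?_) measurableSet_Ioi) _
    simp only [Real.rpow_one, neg_mul]
  have hlim : Tendsto (fun t => gammaLower a t * Real.exp (-t * x)) atTop (𝓝 0) := by
    have h0 := (tendsto_rpow_mul_exp_neg_mul_atTop_nhds_zero a x hx).const_mul
      (Real.Gamma (a + 1))⁻¹
    rw [mul_zero] at h0
    refine squeeze_zero' ?_ ?_ h0
    · filter_upwards [eventually_ge_atTop 0] with t ht
      exact mul_nonneg (gammaLower_nonneg ha ht) (Real.exp_nonneg _)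
    · filter_upwards [eventually_ge_atTop 0] with t ht
      rw [← mul_assoc, inv_mul_eq_div, show -x * t = -t * x by ring]
      exact mul_le_mul_of_nonneg_right (gammaLower_le ha ht) (Real.exp_nonneg _)
  have h2 := integral_Ioi_of_hasDerivAt_of_tendsto
    (((continuous_gammaLower ha).mul (by fun_prop)).continuousWithinAt) h1
    (hI2.sub (hI.const_mul x)) hlim
  rw [integral_sub hI2 (hI.const_mul x), integral_const_mul, integral_const_mul,
    Real.integral_rpow_mul_exp_neg_mul_Ioi (by linarith) (by linarith)] at h2
  have h0 : gammaLower a 0 = 0 := by simp [gammaLower]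
  rw [Pi.mul_apply, h0, zero_mul, sub_zero, one_div, Real.inv_rpow (by linarith), ← Real.rpow_neg (by linarith)]
    at h2
  rw [eq_div_iff hx.ne']
  generalize ∫ t in Ioi (0 : ℝ), gammaLower a t * Real.exp (-t * x) = I at h2 ⊢
  field_simp at h2
  linarith

end gammaLower

/-! ### The truncated power and its Mellin transform -/

/-- The function `1 - (1 - x)₊^b`. -/
noncomputable def powDefect (b x : ℝ) : ℝ := 1 - max (1 - x) 0 ^ b

section powDefect

variable {b : ℝ} (hb : 0 < b)
include hb

theorem continuous_powDefect : Continuous (powDefect b) :=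
  continuous_const.sub ((Real.continuous_rpow_const hb.le).comp (by fun_prop))

theorem powDefect_nonneg {x : ℝ} (hx : 0 ≤ x) : 0 ≤ powDefect b x :=
  sub_nonneg.2 (Real.rpow_le_one (le_max_right _ _) (max_le (by linarith) zero_le_one) hb.le)

omit hb in
theorem powDefect_le_one (x : ℝ) : powDefect b x ≤ 1 :=
  sub_le_self _ (Real.rpow_nonneg (le_max_right _ _) _)

theorem powDefect_of_one_le {x : ℝ} (hx : 1 ≤ x) : powDefect b x = 1 := by
  rw [powDefect, max_eq_right (by linarith), Real.zero_rpow hb.ne', sub_zero]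

omit hb in
theorem powDefect_of_le_one {x : ℝ} (hx : x ≤ 1) : powDefect b x = 1 - (1 - x) ^ b := by
  rw [powDefect, max_eq_left (by linarith)]

/-- Bernoulli's inequality for b ≥ 1, and (1-x)^b ≥ 1-x for b ≤ 1. Linear vanishing at 0 makes
w^{-α-1} integrable against the defect there, and yields the 1/t decay of `powDefectLaplace`. -/
theorem powDefect_le_mul {x : ℝ} (hx : 0 ≤ x) : powDefect b x ≤ max 1 b * x := by
  have h1 : x ≤ max 1 b * x := le_mul_of_one_le_left hx (le_max_left _ _)
  rcases le_total 1 x with h | h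
  · rw [powDefect_of_one_le hb h]; linarith
  rw [powDefect_of_le_one h]
  rcases le_total 1 b with h' | h'
  · have := one_add_mul_self_le_rpow_one_add (s := -x) (by linarith) h'
    rw [← sub_eq_add_neg] at this
    have h2 : b * x ≤ max 1 b * x := mul_le_mul_of_nonneg_right (le_max_right _ _) hx
    linarith
  · have := Real.rpow_le_rpow_of_exponent_ge' (x := 1 - x) (by linarith) (by linarith) hb.le h'
    rw [Real.rpow_one] at this
    linarith

omit hb in
-- Read off from the fact that the Beta density has total mass 1.
theorem integrableOn_and_integral_beta {p q : ℝ} (hp : 0 < p) (hq : 0 < q) :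
    IntegrableOn (fun x : ℝ => x ^ (p - 1) * (1 - x) ^ (q - 1)) (Ioo 0 1) ∧
    ∫ x in Ioo (0 : ℝ) 1, x ^ (p - 1) * (1 - x) ^ (q - 1) =
      Real.Gamma p * Real.Gamma q / Real.Gamma (p + q) := by
  have hβ := ProbabilityTheory.beta_pos hp hq
  have h := ProbabilityTheory.lintegral_betaPDF_eq_one hp hq
  rw [ProbabilityTheory.lintegral_betaPDF] at h
  have hnn : 0 ≤ᵐ[volume.restrict (Ioo (0 : ℝ) 1)]
      fun x : ℝ => 1 / ProbabilityTheory.beta p q * x ^ (p - 1) * (1 - x) ^ (q - 1) := by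
    refine ae_restrict_of_forall_mem measurableSet_Ioo fun x hx => ?_
    have h1 := hx.1
    have h2 : 0 < 1 - x := by linarith [hx.2]
    simp only [Pi.zero_apply]
    positivity
  have hm : AEStronglyMeasurable (fun x : ℝ => 1 / ProbabilityTheory.beta p q * x ^ (p - 1) *
      (1 - x) ^ (q - 1)) (volume.restrict (Ioo (0 : ℝ) 1)) :=
    Measurable.aestronglyMeasurable (by fun_prop)
  have hI : IntegrableOn (fun x : ℝ => 1 / ProbabilityTheory.beta p q * x ^ (p - 1) *
      (1 - x) ^ (q - 1)) (Ioo 0 1) :=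
    (lintegral_ofReal_ne_top_iff_integrable hm hnn).1 (by rw [h]; simp)
  have hE : ∫ x in Ioo (0 : ℝ) 1, 1 / ProbabilityTheory.beta p q * x ^ (p - 1) *
      (1 - x) ^ (q - 1) = 1 := by
    rw [integral_eq_lintegral_of_nonneg_ae hnn hm, h, ENNReal.toReal_one]
  constructor
  · refine IntegrableOn.congr_fun (hI.const_mul (ProbabilityTheory.beta p q)) (fun x _ => ?_)
      measurableSet_Ioo
    field_simp
  · simp_rw [mul_assoc, integral_const_mul] at hE
    field_simp at hE
    rw [hE, ProbabilityTheory.beta]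

/-- The value of `∫₀^∞ w^{-α-1} (1 - (1-w)₊^b) dw`. -/
noncomputable def mellinConst (α b : ℝ) : ℝ :=
  Real.Gamma (1 - α) * Real.Gamma (b + 1) / (α * Real.Gamma (b + 1 - α))

theorem mellinConst_pos {α : ℝ} (h0 : 0 < α) (h1 : α < 1) : 0 < mellinConst α b := by
  have := Real.Gamma_pos_of_pos (s := 1 - α) (by linarith)
  have := Real.Gamma_pos_of_pos (s := b + 1) (by linarith)
  have := Real.Gamma_pos_of_pos (s := b + 1 - α) (by linarith)
  unfold mellinConst
  positivity

/-- Integrate by parts on (0,1). The boundary term -1/α at w = 1 cancels the tail ∫₁^∞ w^{-α-1} dw =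
1/α, leaving (b/α) B(1-α, b). -/
theorem integral_rpow_mul_powDefect {α : ℝ} (h0 : 0 < α) (h1 : α < 1) :
    ∫ w in Ioi (0 : ℝ), w ^ (-α - 1) * powDefect b w = mellinConst α b := by
  have hsmall : IntegrableOn (fun w : ℝ => w ^ (-α - 1) * powDefect b w) (Ioc 0 1) := by
    have hI : IntegrableOn (fun w : ℝ => max 1 b * w ^ (-α)) (Ioc 0 1) := by
      have := intervalIntegral.intervalIntegrable_rpow' (a := 0) (b := 1) (r := -α) (by linarith)
      rw [intervalIntegrable_iff_integrableOn_Ioc_of_le zero_le_one] at this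
      exact this.const_mul _
    refine hI.mono' (Measurable.aestronglyMeasurable
      ((by fun_prop : Measurable fun w : ℝ => w ^ (-α - 1)).mul
        (continuous_powDefect hb).measurable)) ?_
    refine ae_restrict_of_forall_mem measurableSet_Ioc fun w hw => ?_
    have hw0 := hw.1
    rw [Real.norm_of_nonneg (mul_nonneg (Real.rpow_nonneg hw0.le _) (powDefect_nonneg hb hw0.le))]
    calc w ^ (-α - 1) * powDefect b w ≤ w ^ (-α - 1) * (max 1 b * w) :=
          mul_le_mul_of_nonneg_left (powDefect_le_mul hb hw0.le) (Real.rpow_nonneg hw0.le _)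
      _ = max 1 b * (w ^ (-α - 1) * w ^ (1 : ℝ)) := by rw [Real.rpow_one]; ring
      _ = _ := by rw [← Real.rpow_add hw0]; ring_nf
  have hlarge : EqOn (fun w : ℝ => w ^ (-α - 1) * powDefect b w) (fun w => w ^ (-α - 1))
      (Ioi 1) := fun w hw => by
    simp only [powDefect_of_one_le hb (le_of_lt (mem_Ioi.1 hw)), mul_one]
  have hlI : IntegrableOn (fun w : ℝ => w ^ (-α - 1) * powDefect b w) (Ioi 1) :=
    (integrableOn_Ioi_rpow_of_lt (by linarith) one_pos).congr_fun hlarge.symm measurableSet_Ioi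
  obtain ⟨hβI, hβ⟩ := integrableOn_and_integral_beta (p := 1 - α) (q := b) (by linarith) hb
  have hβI' : IntervalIntegrable (fun x : ℝ => x ^ (1 - α - 1) * (1 - x) ^ (b - 1)) volume 0 1 := by
    rwa [intervalIntegrable_iff_integrableOn_Ioo_of_le zero_le_one]
  have hsI' : IntervalIntegrable (fun w : ℝ => w ^ (-α - 1) * powDefect b w) volume 0 1 := by
    rwa [intervalIntegrable_iff_integrableOn_Ioc_of_le zero_le_one]
  have hparts : ∫ w in (0 : ℝ)..1, (w ^ (-α - 1) * powDefect b w -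
      b / α * (w ^ (1 - α - 1) * (1 - w) ^ (b - 1))) = -α⁻¹ - 0 := by
    -- Endpoint limits replace endpoint derivatives: w^{-α} is singular at 0, and (1-w)^{b-1} is
    -- singular at 1 when b < 1.
    refine intervalIntegral.integral_eq_sub_of_hasDerivAt_of_tendsto
      (f := fun w => -α⁻¹ * (w ^ (-α) * powDefect b w)) zero_lt_one (fun w hw => ?_)
      (hsI'.sub (hβI'.const_mul _)) ?_ ?_
    · have hd1 : HasDerivAt (fun w : ℝ => w ^ (-α)) (-α * w ^ (-α - 1)) w :=
        Real.hasDerivAt_rpow_const (Or.inl hw.1.ne')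
      have hd2 : HasDerivAt (fun w : ℝ => 1 - (1 - w) ^ b) (-(-1 * b * (1 - w) ^ (b - 1))) w :=
        ((((hasDerivAt_id w).const_sub 1).rpow_const
          (Or.inl (by have := hw.2; simp only [id]; linarith))).const_sub 1)
      have hd3 : HasDerivAt (powDefect b) (-(-1 * b * (1 - w) ^ (b - 1))) w := by
        refine hd2.congr_of_eventuallyEq ?_
        filter_upwards [Iio_mem_nhds hw.2] with y hy
        exact powDefect_of_le_one (le_of_lt hy)
      convert! (hd1.mul hd3).const_mul (-α⁻¹) using 1
      rw [show (1 - α - 1) = -α by ring]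
      field_simp
      ring
    · have hlim : Tendsto (fun w : ℝ => max 1 b * w ^ (1 - α)) (𝓝[>] 0) (𝓝 0) := by
        have := ((Real.continuous_rpow_const (q := 1 - α) (by linarith)).tendsto 0).const_mul
          (max 1 b)
        rw [Real.zero_rpow (by linarith), mul_zero] at this
        exact this.mono_left nhdsWithin_le_nhds
      have h2 : Tendsto (fun w : ℝ => w ^ (-α) * powDefect b w) (𝓝[>] 0) (𝓝 0) := by
        refine squeeze_zero' ?_ ?_ hlim
        · filter_upwards [self_mem_nhdsWithin] with w hw
          exact mul_nonneg (Real.rpow_nonneg (le_of_lt hw) _) (powDefect_nonneg hb (le_of_lt hw))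
        · filter_upwards [self_mem_nhdsWithin] with w hw
          have hw0 : 0 < w := hw
          calc w ^ (-α) * powDefect b w ≤ w ^ (-α) * (max 1 b * w) :=
              mul_le_mul_of_nonneg_left (powDefect_le_mul hb hw0.le) (Real.rpow_nonneg hw0.le _)
            _ = max 1 b * (w ^ (-α) * w ^ (1 : ℝ)) := by rw [Real.rpow_one]; ring
            _ = _ := by rw [← Real.rpow_add hw0]; ring_nf
      simpa using h2.const_mul (-α⁻¹)
    · have hc : ContinuousAt (fun w : ℝ => -α⁻¹ * (w ^ (-α) * powDefect b w)) 1 :=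
        ((Real.continuousAt_rpow_const 1 (-α) (Or.inl one_ne_zero)).mul
          (continuous_powDefect hb).continuousAt).const_mul _
      have := hc.tendsto
      simp only [Real.one_rpow, powDefect_of_one_le hb le_rfl, mul_one] at this
      exact this.mono_left nhdsWithin_le_nhds
  rw [intervalIntegral.integral_sub hsI' (hβI'.const_mul _), intervalIntegral.integral_const_mul,
    intervalIntegral.integral_of_le zero_le_one, intervalIntegral.integral_of_le zero_le_one,
    integral_Ioc_eq_integral_Ioo (f := fun x : ℝ => x ^ (1 - α - 1) * (1 - x) ^ (b - 1)), hβ]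
    at hparts
  rw [← Ioc_union_Ioi_eq_Ioi zero_le_one, setIntegral_union (by
      rw [Set.disjoint_left]; intro x hx hx'; exact not_lt.2 hx.2 hx') measurableSet_Ioi hsmall hlI,
    setIntegral_congr_fun measurableSet_Ioi hlarge, integral_Ioi_rpow_of_lt (by linarith) one_pos,
    Real.one_rpow, mellinConst, Real.Gamma_add_one hb.ne']
  have hΓ : Real.Gamma (b + 1 - α) ≠ 0 := (Real.Gamma_pos_of_pos (by linarith)).ne'
  rw [show 1 - α + b = b + 1 - α by ring] at hparts
  rw [eq_add_of_sub_eq hparts, show -α - 1 + 1 = -α by ring]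
  field_simp
  ring

/-- The substitution w = v/t, carried out as the inversion t ↦ t⁻¹ followed by scaling by v. -/
theorem integral_rpow_mul_powDefect_div {α v : ℝ} (h0 : 0 < α) (h1 : α < 1) (hv : 0 < v) :
    ∫ t in Ioi (0 : ℝ), t ^ (α - 1) * powDefect b (v / t) = v ^ α * mellinConst α b := by
  have h2 := integral_comp_rpow_Ioi (fun y : ℝ => (v * y) ^ (-α - 1) * powDefect b (v * y))
    (p := -1) (by norm_num)
  rw [integral_comp_mul_left_Ioi (fun w : ℝ => w ^ (-α - 1) * powDefect b w) 0 hv, mul_zero,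
    integral_rpow_mul_powDefect hb h0 h1] at h2
  have h3 : ∀ t ∈ Ioi (0 : ℝ), (|(-1 : ℝ)| * t ^ ((-1 : ℝ) - 1)) •
      ((v * t ^ (-1 : ℝ)) ^ (-α - 1) * powDefect b (v * t ^ (-1 : ℝ))) =
      v ^ (-α - 1) * (t ^ (α - 1) * powDefect b (v / t)) := by
    intro t ht
    have ht' : 0 < t := ht
    rw [Real.mul_rpow hv.le (Real.rpow_nonneg ht'.le _), ← Real.rpow_mul ht'.le, abs_neg, abs_one,
      one_mul, smul_eq_mul]
    have : t ^ (α - 1) = t ^ ((-1 : ℝ) - 1) * t ^ (-1 * (-α - 1)) := by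
      rw [← Real.rpow_add ht']; ring_nf
    rw [this, Real.rpow_neg_one, ← div_eq_mul_inv]
    ring
  rw [setIntegral_congr_fun measurableSet_Ioi h3, integral_const_mul, smul_eq_mul] at h2
  have h4 : v ^ α * v ^ (-α - 1) = v⁻¹ := by
    rw [← Real.rpow_add hv, ← Real.rpow_neg_one]; ring_nf
  have h5 : v ^ (-α - 1) ≠ 0 := (Real.rpow_pos_of_pos hv _).ne'
  refine mul_left_cancel₀ h5 ?_
  rw [h2, ← h4]; ring

end powDefect

/-- The integral `∫₀^∞ v^{s-1} e^{-vr} (1 - (1 - v/t)₊^b) dv`. -/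
noncomputable def powDefectLaplace (b s r t : ℝ) : ℝ :=
  ∫ v in Ioi (0 : ℝ), v ^ (s - 1) * Real.exp (-v * r) * powDefect b (v / t)

/-! ### Laplace integral of the defect: decay, Mellin transform, error term -/

section powDefectLaplace

theorem integrableOn_rpow_mul_exp_neg_mul {s r : ℝ} (hs : 0 < s) (hr : 0 < r) :
    IntegrableOn (fun v : ℝ => v ^ (s - 1) * Real.exp (-v * r)) (Ioi 0) := by
  refine IntegrableOn.congr_fun (integrableOn_rpow_mul_exp_neg_mul_rpow (p := 1) (s := s - 1)
    (by linarith) one_pos hr) (fun v _ => ?_) measurableSet_Ioi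
  simp only [Real.rpow_one]; ring_nf

theorem integral_rpow_mul_exp_neg_mul {s r : ℝ} (hs : 0 < s) (hr : 0 < r) :
    ∫ v in Ioi (0 : ℝ), v ^ (s - 1) * Real.exp (-v * r) = r ^ (-s) * Real.Gamma s := by
  rw [Real.rpow_neg hr.le, ← Real.inv_rpow hr.le, ← one_div,
    ← Real.integral_rpow_mul_exp_neg_mul_Ioi hs hr]
  simp_rw [neg_mul, mul_comm r]

variable {b s r : ℝ} (hb : 0 < b) (hs : 0 < s) (hr : 0 < r)
include hb

theorem measurable_powDefect : Measurable (powDefect b) := (continuous_powDefect hb).measurable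

theorem powDefectLaplace_nonneg {t : ℝ} (ht : 0 < t) : 0 ≤ powDefectLaplace b s r t :=
  setIntegral_nonneg measurableSet_Ioi fun v hv => by
    have hv' : 0 < v := hv
    have := powDefect_nonneg hb (x := v / t) (by positivity)
    positivity

include hs hr

theorem integrableOn_mul_powDefect (t : ℝ) (ht : 0 < t) :
    IntegrableOn (fun v : ℝ => v ^ (s - 1) * Real.exp (-v * r) * powDefect b (v / t))
      (Ioi 0) := by
  refine (integrableOn_rpow_mul_exp_neg_mul hs hr).mono' ?_ ?_
  · exact Measurable.aestronglyMeasurable (Measurable.mul (by fun_prop)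
      ((measurable_powDefect hb).comp (by fun_prop)))
  · refine ae_restrict_of_forall_mem measurableSet_Ioi fun v hv => ?_
    have hv' : 0 < v := hv
    have h0 := powDefect_nonneg hb (x := v / t) (by positivity)
    rw [Real.norm_of_nonneg (by positivity)]
    exact mul_le_of_le_one_right (by positivity) (powDefect_le_one _)

/-- The linear bound on the defect costs one factor v/t, which raises s to s + 1 in the Gamma
integral. -/
theorem powDefectLaplace_le {t : ℝ} (ht : 0 < t) :
    powDefectLaplace b s r t ≤ max 1 b * Real.Gamma (s + 1) * r ^ (-(s + 1)) * t⁻¹ := by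
  have hI := integrableOn_rpow_mul_exp_neg_mul (s := s + 1) (by linarith) hr
  calc powDefectLaplace b s r t
      ≤ ∫ v in Ioi (0 : ℝ), (max 1 b * t⁻¹) * (v ^ (s + 1 - 1) * Real.exp (-v * r)) := by
        refine setIntegral_mono_on (integrableOn_mul_powDefect hb hs hr t ht) (hI.const_mul _)
          measurableSet_Ioi fun v hv => ?_
        have hv' : 0 < v := hv
        have h1 : v ^ (s + 1 - 1) = v ^ (s - 1) * v := by
          rw [← Real.rpow_add_one hv'.ne']; ring_nf
        rw [h1]
        calc v ^ (s - 1) * Real.exp (-v * r) * powDefect b (v / t)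
            ≤ v ^ (s - 1) * Real.exp (-v * r) * (max 1 b * (v / t)) :=
              mul_le_mul_of_nonneg_left (powDefect_le_mul hb (by positivity)) (by positivity)
          _ = _ := by ring
    _ = _ := by
        rw [integral_const_mul, integral_rpow_mul_exp_neg_mul (by linarith) hr]; ring

/-- The Mellin transform of `powDefectLaplace`. -/
theorem integrableOn_and_integral_rpow_mul_powDefectLaplace {α : ℝ} (h0 : 0 < α) (h1 : α < 1) :
    IntegrableOn (fun t => t ^ (α - 1) * powDefectLaplace b s r t) (Ioi 0) ∧
    ∫ t in Ioi (0 : ℝ), t ^ (α - 1) * powDefectLaplace b s r t =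
      mellinConst α b * Real.Gamma (s + α) * r ^ (-(s + α)) := by
  let f : ℝ → ℝ → ℝ := fun t v =>
    t ^ (α - 1) * (v ^ (s - 1) * Real.exp (-v * r) * powDefect b (v / t))
  have hf : ∀ t v, f t v = v ^ (s - 1) * Real.exp (-v * r) * (t ^ (α - 1) * powDefect b (v / t)) :=
    fun t v => by simp only [f]; ring
  have hM := mellinConst_pos hb h0 h1
  have hinner : ∀ v ∈ Ioi (0 : ℝ), ∫ t in Ioi (0 : ℝ), f t v =
      mellinConst α b * (v ^ (s + α - 1) * Real.exp (-v * r)) := by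
    intro v hv
    simp_rw [hf]
    rw [integral_const_mul, integral_rpow_mul_powDefect_div hb h0 h1 hv,
      show s + α - 1 = (s - 1) + α by ring, Real.rpow_add hv]
    ring
  have hmeas : Measurable (Function.uncurry f) := by
    have h2 : Measurable fun p : ℝ × ℝ => powDefect b (p.2 / p.1) :=
      (measurable_powDefect hb).comp (by fun_prop)
    exact Measurable.mul (by fun_prop) (Measurable.mul (by fun_prop) h2)
  have hint : Integrable (Function.uncurry f)
      ((volume.restrict (Ioi (0 : ℝ))).prod (volume.restrict (Ioi (0 : ℝ)))) := by
    refine (integrable_prod_iff' hmeas.aestronglyMeasurable).2 ⟨?_, ?_⟩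
    · refine ae_restrict_of_forall_mem measurableSet_Ioi fun v hv => ?_
      -- If the slice were not integrable its integral would be 0, but `hinner` gives it a positive
      -- value.
      by_contra hc
      have h2 := integral_undef hc
      simp only [Function.uncurry_apply_pair] at h2
      rw [hinner v hv] at h2
      have hv' : 0 < v := hv
      have : 0 < mellinConst α b * (v ^ (s + α - 1) * Real.exp (-v * r)) := by positivity
      linarith
    · refine IntegrableOn.congr_fun ((integrableOn_rpow_mul_exp_neg_mul (s := s + α)
        (by linarith) hr).const_mul (mellinConst α b)) (fun v hv => ?_) measurableSet_Ioi
      rw [← hinner v hv]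
      refine setIntegral_congr_fun measurableSet_Ioi fun t ht => ?_
      have hv' : 0 < v := hv
      have ht' : 0 < t := ht
      have h2 := powDefect_nonneg hb (x := v / t) (by positivity)
      exact (Real.norm_of_nonneg (by simp only [f]; positivity)).symm
  have hH : ∀ t, ∫ v in Ioi (0 : ℝ), f t v = t ^ (α - 1) * powDefectLaplace b s r t := by
    intro t; simp only [f]; rw [integral_const_mul]; rfl
  constructor
  · have h2 := hint.integral_prod_left
    simp only [Function.uncurry_apply_pair, hH] at h2
    exact h2
  · simp_rw [← hH]
    rw [integral_integral_swap hint, setIntegral_congr_fun measurableSet_Ioi hinner,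
      integral_const_mul, integral_rpow_mul_exp_neg_mul (by linarith) hr]
    ring

omit hs hr in
-- The substitution v = ut/(t+u) maps (0,∞) onto (0,t), with 1 - v/t = t/(t+u) and Jacobian
-- t²/(t+u)². The powers of t+u match because (s-1) + b + 2 = δ + 1.
theorem integral_Ioi_rpow_mul_rpow_mul_exp {δ : ℝ} (hδ : δ = s + b) {t : ℝ} (ht : 0 < t) :
    ∫ u in Ioi (0 : ℝ), u ^ (s - 1) * ((t + u) ^ (-(δ + 1)) * Real.exp (-(u * t / (t + u)) * r)) =
      t ^ (-(δ + 1)) * ∫ v in Ioi (0 : ℝ), v ^ (s - 1) * Real.exp (-v * r) *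
        max (1 - v / t) 0 ^ b := by
  let g : ℝ → ℝ := fun v => v ^ (s - 1) * Real.exp (-v * r) * max (1 - v / t) 0 ^ b
  have himg : (fun u : ℝ => u * t / (t + u)) '' Ioi 0 = Ioo 0 t := by
    ext v
    simp only [mem_image, mem_Ioi, mem_Ioo]
    constructor
    · rintro ⟨u, hu, rfl⟩
      exact ⟨by positivity, by rw [div_lt_iff₀ (by positivity)]; nlinarith⟩
    · rintro ⟨h1, h2⟩
      have h3 : 0 < t - v := by linarith
      refine ⟨v * t / (t - v), by positivity, ?_⟩
      field_simp
      ring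
  have hsub : ∫ v in Ioi (0 : ℝ), g v = ∫ v in Ioo 0 t, g v := by
    refine setIntegral_eq_of_subset_of_forall_sdiff_eq_zero measurableSet_Ioi
      (fun x hx => hx.1) fun v hv => ?_
    have h1 : t ≤ v := by
      by_contra h; exact hv.2 ⟨hv.1, not_le.1 h⟩
    have h2 : 1 - v / t ≤ 0 := by rw [sub_nonpos, le_div_iff₀ ht]; linarith
    simp only [g, max_eq_right h2, Real.zero_rpow hb.ne', mul_zero]
  change _ = t ^ (-(δ + 1)) * ∫ v in Ioi (0 : ℝ), g v
  rw [hsub, ← himg, integral_image_eq_integral_abs_deriv_smul (f' := fun u => t ^ 2 / (t + u) ^ 2)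
    measurableSet_Ioi, ← integral_const_mul]
  · refine setIntegral_congr_fun measurableSet_Ioi fun u hu => ?_
    have hu' : 0 < u := hu
    have htu : 0 < t + u := by positivity
    have h1 : 1 - u * t / (t + u) / t = t / (t + u) := by field_simp; ring
    simp only [g, smul_eq_mul]
    rw [h1, max_eq_left (by positivity), abs_of_nonneg (by positivity),
      Real.div_rpow (by positivity) htu.le, Real.div_rpow ht.le htu.le,
      Real.mul_rpow hu'.le ht.le]
    have e1 : (t + u) ^ (-(δ + 1)) =
        ((t + u) ^ (2 : ℕ))⁻¹ * ((t + u) ^ (s - 1))⁻¹ * ((t + u) ^ b)⁻¹ := by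
      rw [← Real.rpow_natCast, ← Real.rpow_neg htu.le, ← Real.rpow_neg htu.le,
        ← Real.rpow_neg htu.le, ← Real.rpow_add htu, ← Real.rpow_add htu]
      congr 1; rw [hδ]; push_cast; ring
    have e2 : t ^ (-(δ + 1)) * (t ^ (2 : ℕ) * t ^ (s - 1) * t ^ b) = 1 := by
      rw [← Real.rpow_natCast, ← Real.rpow_add ht, ← Real.rpow_add ht, ← Real.rpow_add ht,
        hδ]
      convert! Real.rpow_zero t using 2
      push_cast; ring
    rw [e1]
    calc _ = (t ^ (-(δ + 1)) * (t ^ (2 : ℕ) * t ^ (s - 1) * t ^ b)) * (u ^ (s - 1) *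
        (((t + u) ^ (2 : ℕ))⁻¹ * ((t + u) ^ (s - 1))⁻¹ * ((t + u) ^ b)⁻¹ *
          Real.exp (-(u * t / (t + u)) * r))) := by rw [e2, one_mul]
      _ = _ := by simp only [div_eq_mul_inv]; ring
  · intro u hu
    have hu' : 0 < u := hu
    have htu : t + u ≠ 0 := by positivity
    have h1 : HasDerivAt (fun u : ℝ => u * t) (1 * t) u := (hasDerivAt_id u).mul_const t
    have h2 : HasDerivAt (fun u : ℝ => t + u) 1 u := (hasDerivAt_id u).const_add t
    convert! (h1.div h2 htu).hasDerivWithinAt using 1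
    congr 1; ring
  · intro u hu w hw h
    have hu' : 0 < u := hu
    have hw' : 0 < w := hw
    simp only at h
    rw [div_eq_div_iff (by positivity) (by positivity)] at h
    have : t ^ 2 * (u - w) = 0 := by linarith
    rcases mul_eq_zero.1 this with h3 | h3
    · exact absurd h3 (by positivity)
    · linarith

theorem integral_Ioi_rpow_mul_rpow_mul_exp_eq_sub {δ : ℝ} (hδ : δ = s + b) {t : ℝ} (ht : 0 < t) :
    ∫ u in Ioi (0 : ℝ), u ^ (s - 1) * ((t + u) ^ (-(δ + 1)) * Real.exp (-(u * t / (t + u)) * r)) =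
      t ^ (-(δ + 1)) * (r ^ (-s) * Real.Gamma s - powDefectLaplace b s r t) := by
  rw [integral_Ioi_rpow_mul_rpow_mul_exp hb hδ ht, ← integral_rpow_mul_exp_neg_mul hs hr,
    powDefectLaplace, ← integral_sub (integrableOn_rpow_mul_exp_neg_mul hs hr)
      (integrableOn_mul_powDefect hb hs hr t ht)]
  congr 1
  refine integral_congr_ae (Eventually.of_forall fun v => ?_)
  simp only [powDefect]
  ring

omit hr hs hb in
theorem integrableOn_min_rpow {α : ℝ} (h0 : 0 < α) (h1 : α < 1) :
    IntegrableOn (fun t : ℝ => min (t ^ (α - 1)) (t ^ (α - 2))) (Ioi 0) := by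
  have hm : Measurable fun t : ℝ => min (t ^ (α - 1)) (t ^ (α - 2)) := by fun_prop
  rw [← Ioc_union_Ioi_eq_Ioi zero_le_one]
  refine IntegrableOn.union ?_ ?_
  · have := intervalIntegral.intervalIntegrable_rpow' (a := 0) (b := 1) (r := α - 1) (by linarith)
    rw [intervalIntegrable_iff_integrableOn_Ioc_of_le zero_le_one] at this
    refine this.mono' hm.aestronglyMeasurable
      (ae_restrict_of_forall_mem measurableSet_Ioc fun t ht => ?_)
    have := ht.1
    rw [Real.norm_of_nonneg (by positivity)]
    exact min_le_left _ _
  · refine (integrableOn_Ioi_rpow_of_lt (a := α - 2) (by linarith) one_pos).mono'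
      hm.aestronglyMeasurable (ae_restrict_of_forall_mem measurableSet_Ioi fun t ht => ?_)
    have : 0 < t := lt_trans one_pos ht
    rw [Real.norm_of_nonneg (by positivity)]
    exact min_le_right _ _

omit hr in
/-- Replacing `gammaLower a t` by its leading power `t^a / Γ(a+1)` changes the integral by
`O(r^{-(s+1)})`. -/
theorem exists_integral_gammaLower_mul_powDefectLaplace_bound {α δ : ℝ} (h0 : 0 < α) (h1 : α < 1)
    (hδ : 1 ≤ δ) :
    ∃ C : ℝ, 0 < C ∧ ∀ r : ℝ, 0 < r →
      |mellinConst α b * Real.Gamma (s + α) * r ^ (-(s + α)) / Real.Gamma (δ + α + 1) -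
        ∫ t in Ioi (0 : ℝ), gammaLower (δ + α) t * (t ^ (-(δ + 1)) * powDefectLaplace b s r t)|
        ≤ C * r ^ (-(s + 1)) := by
  have ha : 1 ≤ δ + α := by linarith
  have hΓ : 0 < Real.Gamma (δ + α) := Real.Gamma_pos_of_pos (by linarith)
  have hΓ1 : 0 < Real.Gamma (δ + α + 1) := Real.Gamma_pos_of_pos (by linarith)
  have hΓs : 0 < Real.Gamma (s + 1) := Real.Gamma_pos_of_pos (by linarith)
  set A : ℝ := (Real.Gamma (δ + α))⁻¹ + (Real.Gamma (δ + α + 1))⁻¹ with hA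
  have hA0 : 0 < A := by positivity
  have hB : 0 < max 1 b := lt_max_of_lt_left one_pos
  set J : ℝ := ∫ t in Ioi (0 : ℝ), min (t ^ (α - 1)) (t ^ (α - 2)) with hJ
  have hJ0 : 0 ≤ J := setIntegral_nonneg measurableSet_Ioi fun t ht => by
    have : 0 < t := ht
    positivity
  -- `J + 1` in place of `J` makes the constant positive without showing that `J` is.
  refine ⟨A * (max 1 b * Real.Gamma (s + 1)) * (J + 1), by positivity, fun r hr => ?_⟩
  obtain ⟨hMI, hM⟩ := integrableOn_and_integral_rpow_mul_powDefectLaplace hb hs hr h0 h1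
  have hpow : ∀ t ∈ Ioi (0 : ℝ), t ^ (α - 1) * powDefectLaplace b s r t / Real.Gamma (δ + α + 1) =
      t ^ (δ + α) / Real.Gamma (δ + α + 1) * (t ^ (-(δ + 1)) * powDefectLaplace b s r t) := by
    intro t ht
    have e : t ^ (α - 1) = t ^ (δ + α) * t ^ (-(δ + 1)) := by
      rw [← Real.rpow_add ht]; ring_nf
    rw [e]; ring
  -- Measurability in t is inherited from the Fubini argument behind `hMI`, after adjusting the
  -- power of t.
  have hHm : AEStronglyMeasurable (fun t => t ^ (-(δ + 1)) * powDefectLaplace b s r t)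
      (volume.restrict (Ioi 0)) := by
    have h2 : AEStronglyMeasurable (fun t : ℝ => t ^ (-(δ + α)))
      (volume.restrict (Ioi 0)) := Measurable.aestronglyMeasurable (by fun_prop)
    refine (h2.mul hMI.aestronglyMeasurable).congr
      (ae_restrict_of_forall_mem measurableSet_Ioi fun t ht => ?_)
    have e : t ^ (-(δ + 1)) = t ^ (-(δ + α)) * t ^ (α - 1) := by
      rw [← Real.rpow_add ht]; ring_nf
    simp only [Pi.mul_apply, e, mul_assoc]
  have hMI' := hMI.div_const (Real.Gamma (δ + α + 1))
  have hGI : IntegrableOn (fun t => gammaLower (δ + α) t *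
      (t ^ (-(δ + 1)) * powDefectLaplace b s r t)) (Ioi 0) := by
    refine hMI'.mono' ((continuous_gammaLower ha).aestronglyMeasurable.mul hHm)
      (ae_restrict_of_forall_mem measurableSet_Ioi fun t ht => ?_)
    have ht' : 0 < t := ht
    have h2 := powDefectLaplace_nonneg (s := s) (r := r) hb ht'
    have h3 := gammaLower_nonneg ha ht'.le
    rw [Real.norm_of_nonneg (by positivity), hpow t ht]
    exact mul_le_mul_of_nonneg_right (gammaLower_le ha ht'.le) (by positivity)
  have hdiff : mellinConst α b * Real.Gamma (s + α) * r ^ (-(s + α)) / Real.Gamma (δ + α + 1) -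
      ∫ t in Ioi (0 : ℝ), gammaLower (δ + α) t * (t ^ (-(δ + 1)) * powDefectLaplace b s r t) =
      ∫ t in Ioi (0 : ℝ), (t ^ (δ + α) / Real.Gamma (δ + α + 1) - gammaLower (δ + α) t) *
        (t ^ (-(δ + 1)) * powDefectLaplace b s r t) := by
    rw [← hM, ← integral_div, ← integral_sub hMI' hGI]
    refine setIntegral_congr_fun measurableSet_Ioi fun t ht => ?_
    simp only [hpow t ht]; ring
  rw [hdiff, ← Real.norm_eq_abs]
  have hbound : ∀ t ∈ Ioi (0 : ℝ),
      ‖(t ^ (δ + α) / Real.Gamma (δ + α + 1) - gammaLower (δ + α) t) *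
        (t ^ (-(δ + 1)) * powDefectLaplace b s r t)‖ ≤
      A * (max 1 b * Real.Gamma (s + 1)) * r ^ (-(s + 1)) * min (t ^ (α - 1)) (t ^ (α - 2)) := by
    intro t ht
    have ht' : 0 < t := ht
    have h2 := powDefectLaplace_nonneg (s := s) (r := r) hb ht'
    have h3 := powDefectLaplace_le hb hs hr ht'
    have h4 := sub_nonneg.2 (gammaLower_le ha ht'.le)
    have h5 := rpow_div_Gamma_sub_gammaLower_le ha ht'.le
    -- The first bound is the useful one for small t, the second for large t; `A` adds the two
    -- constants so that a single prefactor covers both.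
    have h6 : t ^ (δ + α) / Real.Gamma (δ + α + 1) - gammaLower (δ + α) t ≤
        A * min (t ^ (δ + α + 1)) (t ^ (δ + α)) := by
      rw [mul_min_of_nonneg _ _ hA0.le, hA, add_mul, add_mul]
      refine le_min ?_ ?_
      · have : 0 ≤ (Real.Gamma (δ + α + 1))⁻¹ * t ^ (δ + α + 1) := by positivity
        rw [div_eq_inv_mul _ (Real.Gamma (δ + α))] at h5
        linarith
      · have h7 := gammaLower_nonneg ha ht'.le
        have : 0 ≤ (Real.Gamma (δ + α))⁻¹ * t ^ (δ + α) := by positivity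
        rw [div_eq_inv_mul]
        linarith
    rw [Real.norm_of_nonneg (by positivity)]
    have e1 : t ^ (δ + α + 1) * (t ^ (-(δ + 1)) * t⁻¹) = t ^ (α - 1) := by
      rw [← Real.rpow_neg_one, ← Real.rpow_add ht', ← Real.rpow_add ht']; ring_nf
    have e2 : t ^ (δ + α) * (t ^ (-(δ + 1)) * t⁻¹) = t ^ (α - 2) := by
      rw [← Real.rpow_neg_one, ← Real.rpow_add ht', ← Real.rpow_add ht']; ring_nf
    calc _ ≤ (A * min (t ^ (δ + α + 1)) (t ^ (δ + α))) * (t ^ (-(δ + 1)) *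
          (max 1 b * Real.Gamma (s + 1) * r ^ (-(s + 1)) * t⁻¹)) := by gcongr
      _ = A * (max 1 b * Real.Gamma (s + 1)) * r ^ (-(s + 1)) *
          (min (t ^ (δ + α + 1)) (t ^ (δ + α)) * (t ^ (-(δ + 1)) * t⁻¹)) := by ring
      _ = _ := by rw [min_mul_of_nonneg _ _ (by positivity), e1, e2]
  calc _ ≤ ∫ t in Ioi (0 : ℝ), A * (max 1 b * Real.Gamma (s + 1)) * r ^ (-(s + 1)) *
        min (t ^ (α - 1)) (t ^ (α - 2)) :=
        norm_integral_le_of_norm_le ((integrableOn_min_rpow h0 h1).const_mul _)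
          (ae_restrict_of_forall_mem measurableSet_Ioi hbound)
    _ = A * (max 1 b * Real.Gamma (s + 1)) * J * r ^ (-(s + 1)) := by
        rw [integral_const_mul]; ring
    _ ≤ _ := by gcongr; linarith

end powDefectLaplace

/-! ### Representation of the flux function -/

/-- Strict positivity allows this factor to be divided out when integrability of a Fubini slice is
transferred to the Gaussian integrand. -/
theorem gammaLower_pos {a t : ℝ} (ha : 1 ≤ a) (ht : 0 < t) : 0 < gammaLower a t := by
  refine mul_pos (inv_pos.2 (Real.Gamma_pos_of_pos (by linarith)))
    (intervalIntegral.intervalIntegral_pos_of_pos_on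
      ((continuous_rpow_mul_exp_neg ha).intervalIntegrable _ _) (fun τ hτ => ?_) ht)
  have := hτ.1
  positivity

theorem Real.sq_rpow_neg {x : ℝ} (hx : 0 ≤ x) (s : ℝ) : (x ^ 2) ^ (-s) = x ^ (-(2 * s)) := by
  rw [← Real.rpow_natCast, ← Real.rpow_mul hx]; congr 1; push_cast; ring

section flux

variable {d : ℕ} {α s : ℝ} {ξ : EuclideanSpace ℝ (Fin d)}

/-- The difference `|ξ - z|^{-2s} - |ξ|^{-2s}`. -/
noncomputable def rieszDiff (s : ℝ) (ξ z : EuclideanSpace ℝ (Fin d)) : ℝ :=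
  ‖ξ - z‖ ^ (-(2 * s)) - ‖ξ‖ ^ (-(2 * s))

theorem measurable_rieszDiff : Measurable (rieszDiff s ξ) := by
  unfold rieszDiff; fun_prop

/-- Within distance 1 of ξ the Riesz singularity is integrable since 2s < d and the bracket is at
most 1. Elsewhere the Riesz factor is at most 1 and the bracket is integrable since α > 0. -/
theorem integrable_one_add_norm_sq_mul_norm_sub_rpow (hd : 1 ≤ d) (hα0 : 0 < α) (hs0 : 0 < s)
    (hs1 : s < (d : ℝ) / 2) :
    Integrable fun z : EuclideanSpace ℝ (Fin d) =>
      (1 + ‖z‖ ^ 2) ^ (-((d : ℝ) / 2 + α)) * ‖ξ - z‖ ^ (-(2 * s)) := by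
  have h1 : Integrable fun z : EuclideanSpace ℝ (Fin d) =>
      (1 + ‖z‖ ^ 2) ^ (-((d : ℝ) / 2 + α)) := by
    have := integrable_rpow_neg_one_add_norm_sq (E := EuclideanSpace ℝ (Fin d)) (μ := volume)
      (r := d + 2 * α) (by rw [finrank_euclideanSpace_fin]; linarith)
    rwa [show -((d : ℝ) + 2 * α) / 2 = -((d : ℝ) / 2 + α) by ring] at this
  have h2 : IntegrableOn (fun η : EuclideanSpace ℝ (Fin d) => ‖η‖ ^ (-(2 * s)))
      (Metric.ball 0 1) := by
    refine integrableOn_ball_of_norm_le_rpow (C := 1) (α := 2 * s)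
      (by rwa [finrank_euclideanSpace_fin])
      (by rw [finrank_euclideanSpace_fin]; linarith) (Eventually.of_forall fun x => ?_)
      (Measurable.aestronglyMeasurable (by fun_prop))
    rw [Real.norm_of_nonneg (by positivity), one_mul]
  have h3 := ((integrable_indicator_iff Metric.isOpen_ball.measurableSet).2 h2).comp_sub_left ξ
  refine (h1.add h3).mono' (Measurable.aestronglyMeasurable (by fun_prop))
    (Eventually.of_forall fun z => ?_)
  rw [Real.norm_of_nonneg (by positivity), Pi.add_apply]
  have h4 : (1 + ‖z‖ ^ 2) ^ (-((d : ℝ) / 2 + α)) ≤ 1 :=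
    Real.rpow_le_one_of_one_le_of_nonpos (by nlinarith [sq_nonneg ‖z‖])
      (neg_nonpos.2 (by positivity))
  by_cases h : ξ - z ∈ Metric.ball (0 : EuclideanSpace ℝ (Fin d)) 1
  · rw [indicator_of_mem h]
    have h5 : 0 ≤ ‖ξ - z‖ ^ (-(2 * s)) := by positivity
    have h6 : 0 ≤ (1 + ‖z‖ ^ 2) ^ (-((d : ℝ) / 2 + α)) := by positivity
    nlinarith
  · rw [indicator_of_notMem h, add_zero]
    rw [mem_ball_zero_iff, not_lt] at h
    exact mul_le_of_le_one_right (by positivity)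
      (Real.rpow_le_one_of_one_le_of_nonpos h (by linarith))

theorem fluxIntegrand_sub {z : EuclideanSpace ℝ (Fin d)} (hz : z ≠ 0) :
    fluxIntegrand α s ξ (ξ - z) =
      (1 + ‖z‖ ^ 2) ^ (-((d : ℝ) / 2 + α)) / ‖z‖ ^ 2 * (transverseForm ξ z * rieszDiff s ξ z) := by
  have h1 : (0 : ℝ) ≤ 1 + ‖z‖ ^ 2 := by positivity
  rw [fluxIntegrand, sub_sub_cancel, sq_norm_projPerp ξ hz, japaneseBracket, rieszDiff,
    Real.sqrt_eq_rpow, ← Real.rpow_mul h1, Real.rpow_neg (norm_nonneg _),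
    Real.rpow_neg (norm_nonneg _), Real.rpow_neg h1,
    show 1 / 2 * ((d : ℝ) + 2 * α) = (d : ℝ) / 2 + α by ring]
  ring

theorem ae_ne_zero (hd : 1 ≤ d) (x : EuclideanSpace ℝ (Fin d)) :
    ∀ᵐ z : EuclideanSpace ℝ (Fin d), z ≠ x := by
  have : Nontrivial (EuclideanSpace ℝ (Fin d)) := by
    apply Module.nontrivial_of_finrank_pos (R := ℝ)
    rw [finrank_euclideanSpace_fin]; omega
  exact Measure.ae_ne volume x

/-- The form is at most |ξ|²|z|², which cancels the singular factor |z|^{-2}; the two Riesz terms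
are then dominated separately. -/
theorem integrable_div_mul_transverseForm_mul_rieszDiff (hd : 1 ≤ d) (hα0 : 0 < α) (hs0 : 0 < s)
    (hs1 : s < (d : ℝ) / 2) :
    Integrable fun z : EuclideanSpace ℝ (Fin d) =>
      (1 + ‖z‖ ^ 2) ^ (-((d : ℝ) / 2 + α)) / ‖z‖ ^ 2 *
        (transverseForm ξ z * rieszDiff s ξ z) := by
  have h1 := integrable_one_add_norm_sq_mul_norm_sub_rpow (ξ := ξ) hd hα0 hs0 hs1
  have h2 : Integrable fun z : EuclideanSpace ℝ (Fin d) =>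
      (1 + ‖z‖ ^ 2) ^ (-((d : ℝ) / 2 + α)) := by
    have := integrable_rpow_neg_one_add_norm_sq (E := EuclideanSpace ℝ (Fin d)) (μ := volume)
      (r := d + 2 * α) (by rw [finrank_euclideanSpace_fin]; linarith)
    rwa [show -((d : ℝ) + 2 * α) / 2 = -((d : ℝ) / 2 + α) by ring] at this
  refine ((h1.add (h2.mul_const (‖ξ‖ ^ (-(2 * s))))).const_mul (‖ξ‖ ^ 2)).mono'
    (Measurable.aestronglyMeasurable (Measurable.mul (by fun_prop)
      ((continuous_transverseForm ξ).measurable.mul measurable_rieszDiff))) ?_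
  filter_upwards [ae_ne_zero hd 0] with z hz
  have hz' : 0 < ‖z‖ := norm_pos_iff.2 hz
  have hQ := transverseForm_nonneg ξ z
  have hQ2 : transverseForm ξ z / ‖z‖ ^ 2 ≤ ‖ξ‖ ^ 2 := by
    rw [div_le_iff₀ (by positivity), transverseForm]
    nlinarith [sq_nonneg (inner ℝ z ξ)]
  have hR : |rieszDiff s ξ z| ≤ ‖ξ - z‖ ^ (-(2 * s)) + ‖ξ‖ ^ (-(2 * s)) := by
    refine (abs_sub _ _).trans_eq ?_
    rw [abs_of_nonneg (by positivity), abs_of_nonneg (by positivity)]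
  rw [Real.norm_eq_abs, abs_mul, abs_mul, abs_of_nonneg hQ, abs_of_nonneg (by positivity)]
  simp only [Pi.add_apply]
  calc (1 + ‖z‖ ^ 2) ^ (-((d : ℝ) / 2 + α)) / ‖z‖ ^ 2 * (transverseForm ξ z * |rieszDiff s ξ z|)
      = (1 + ‖z‖ ^ 2) ^ (-((d : ℝ) / 2 + α)) * ((transverseForm ξ z / ‖z‖ ^ 2) *
          |rieszDiff s ξ z|) := by ring
    _ ≤ (1 + ‖z‖ ^ 2) ^ (-((d : ℝ) / 2 + α)) * (‖ξ‖ ^ 2 *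
          (‖ξ - z‖ ^ (-(2 * s)) + ‖ξ‖ ^ (-(2 * s)))) := by gcongr
    _ = _ := by ring

theorem integrable_fluxIntegrand (hd : 1 ≤ d) (hα0 : 0 < α) (hs0 : 0 < s)
    (hs1 : s < (d : ℝ) / 2) :
    Integrable fun η : EuclideanSpace ℝ (Fin d) => fluxIntegrand α s ξ η := by
  rw [← integrable_comp_sub_left _ ξ]
  refine (integrable_div_mul_transverseForm_mul_rieszDiff (ξ := ξ) hd hα0 hs0 hs1).congr ?_
  filter_upwards [ae_ne_zero hd 0] with z hz
  exact (fluxIntegrand_sub hz).symm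

/-- Write |ξ-z|^{-2s} as a Gamma integral in u and exchange the integrals. The full Gamma integral
r^{-s}Γ(s) produced by the change of variables cancels against the |ξ|^{-2s} term, so only the
defect survives. -/
theorem integral_transverseForm_mul_exp_mul_rieszDiff (hd : 2 ≤ d) (hξ : ξ ≠ 0) (hs0 : 0 < s)
    (hs1 : s < (d : ℝ) / 2) {t : ℝ} (ht : 0 < t)
    (hint : Integrable fun z : EuclideanSpace ℝ (Fin d) =>
      transverseForm ξ z * Real.exp (-t * ‖z‖ ^ 2) * rieszDiff s ξ z) :
    ∫ z, transverseForm ξ z * Real.exp (-t * ‖z‖ ^ 2) * rieszDiff s ξ z =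
      -(((d : ℝ) - 1) * Real.pi ^ ((d : ℝ) / 2) / (2 * Real.Gamma s) * ‖ξ‖ ^ 2) *
        (t ^ (-((d : ℝ) / 2 + 1)) * powDefectLaplace ((d : ℝ) / 2 - s) s (‖ξ‖ ^ 2) t) := by
  have hr : 0 < ‖ξ‖ ^ 2 := by have := norm_pos_iff.2 hξ; positivity
  have hΓ : 0 < Real.Gamma s := Real.Gamma_pos_of_pos hs0
  have hconv : ∀ c : ℝ, 0 < c → ‖ξ‖ ^ 2 * ((d : ℝ) - 1) / (2 * c) *
      (Real.pi / c) ^ ((d : ℝ) / 2) = ‖ξ‖ ^ 2 * ((d : ℝ) - 1) / 2 * Real.pi ^ ((d : ℝ) / 2) *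
        c ^ (-((d : ℝ) / 2 + 1)) := by
    intro c hc
    rw [Real.div_rpow Real.pi_pos.le hc.le, Real.rpow_neg hc.le, Real.rpow_add_one hc.ne']
    field_simp
  obtain ⟨hGI, hG⟩ := integrable_transverseForm_mul_exp_and_integral_eq (ξ := ξ) hd ht
  have hI1 : Integrable fun z : EuclideanSpace ℝ (Fin d) =>
      transverseForm ξ z * Real.exp (-t * ‖z‖ ^ 2) * ‖ξ - z‖ ^ (-(2 * s)) := by
    refine (hint.add (hGI.mul_const (‖ξ‖ ^ (-(2 * s))))).congr (Eventually.of_forall fun z => ?_)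
    simp only [Pi.add_apply, rieszDiff]; ring
  let k : EuclideanSpace ℝ (Fin d) → ℝ → ℝ := fun z u =>
    transverseForm ξ z * Real.exp (-t * ‖z‖ ^ 2) * (u ^ (s - 1) * Real.exp (-u * ‖ξ - z‖ ^ 2))
  have hku : ∀ z, z ≠ ξ → ∫ u in Ioi (0 : ℝ), k z u =
      transverseForm ξ z * Real.exp (-t * ‖z‖ ^ 2) * ‖ξ - z‖ ^ (-(2 * s)) * Real.Gamma s := by
    intro z hz
    have h1 : 0 < ‖ξ - z‖ ^ 2 := by
      have := norm_pos_iff.2 (sub_ne_zero.2 hz.symm); positivity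
    simp only [k]
    rw [integral_const_mul, integral_rpow_mul_exp_neg_mul hs0 h1, Real.sq_rpow_neg (norm_nonneg _)]
    ring
  have hkm : Measurable (Function.uncurry k) := by
    have h1 : Measurable fun p : EuclideanSpace ℝ (Fin d) × ℝ => transverseForm ξ p.1 :=
      (continuous_transverseForm ξ).measurable.comp measurable_fst
    exact Measurable.mul (Measurable.mul h1 (by fun_prop)) (by fun_prop)
  have hkI : Integrable (Function.uncurry k) (volume.prod (volume.restrict (Ioi (0 : ℝ)))) := by
    refine (integrable_prod_iff hkm.aestronglyMeasurable).2 ⟨?_, ?_⟩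
    · filter_upwards [ae_ne_zero (by omega) ξ] with z hz
      have h1 : 0 < ‖ξ - z‖ ^ 2 := by
        have := norm_pos_iff.2 (sub_ne_zero.2 hz.symm); positivity
      exact (integrableOn_rpow_mul_exp_neg_mul hs0 h1).const_mul
        (transverseForm ξ z * Real.exp (-t * ‖z‖ ^ 2))
    · refine (hI1.mul_const (Real.Gamma s)).congr ?_
      filter_upwards [ae_ne_zero (by omega) ξ] with z hz
      rw [← hku z hz]
      refine setIntegral_congr_fun measurableSet_Ioi fun u hu => ?_
      have hu' : 0 < u := hu
      have := transverseForm_nonneg ξ z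
      exact (Real.norm_of_nonneg (by simp only [k]; positivity)).symm
  have hkz : ∀ u ∈ Ioi (0 : ℝ), ∫ z, k z u =
      ‖ξ‖ ^ 2 * ((d : ℝ) - 1) / 2 * Real.pi ^ ((d : ℝ) / 2) * (u ^ (s - 1) *
        ((t + u) ^ (-((d : ℝ) / 2 + 1)) * Real.exp (-(u * t / (t + u)) * ‖ξ‖ ^ 2))) := by
    intro u hu
    have hu' : 0 < u := hu
    have h1 : ∀ z, k z u = u ^ (s - 1) * (transverseForm ξ z * Real.exp (-t * ‖z‖ ^ 2) *
        Real.exp (-u * ‖ξ - z‖ ^ 2)) := fun z => by simp only [k]; ring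
    simp_rw [h1]
    rw [integral_const_mul, (integrable_transverseForm_mul_exp_mul_exp_and_integral_eq hd ht hu').2,
      hconv (t + u) (by positivity)]
    ring
  have hswap := integral_integral_swap hkI
  rw [setIntegral_congr_fun measurableSet_Ioi hkz, integral_const_mul,
    integral_Ioi_rpow_mul_rpow_mul_exp_eq_sub (b := (d : ℝ) / 2 - s) (by linarith) hs0 hr
      (by ring) ht,
    integral_congr_ae ((ae_ne_zero (by omega) ξ).mono hku), integral_mul_const] at hswap
  have hsplit : ∫ z, transverseForm ξ z * Real.exp (-t * ‖z‖ ^ 2) * rieszDiff s ξ z =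
      (∫ z, transverseForm ξ z * Real.exp (-t * ‖z‖ ^ 2) * ‖ξ - z‖ ^ (-(2 * s))) -
        (∫ z, transverseForm ξ z * Real.exp (-t * ‖z‖ ^ 2)) * ‖ξ‖ ^ (-(2 * s)) := by
    rw [← integral_mul_const, ← integral_sub hI1 (hGI.mul_const _)]
    refine integral_congr_ae (Eventually.of_forall fun z => ?_)
    simp only [rieszDiff]; ring
  rw [hsplit, eq_div_of_mul_eq hΓ.ne' hswap, hG, hconv t ht, ← Real.sq_rpow_neg (norm_nonneg _)]
  field_simp
  ring

theorem integral_fluxIntegrand_eq (hd : 2 ≤ d) (hξ : ξ ≠ 0) (hα0 : 0 < α) (hs0 : 0 < s)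
    (hs1 : s < (d : ℝ) / 2) :
    ∫ η, fluxIntegrand α s ξ η =
      -(((d : ℝ) - 1) * Real.pi ^ ((d : ℝ) / 2) / (2 * Real.Gamma s) * ‖ξ‖ ^ 2) *
        ∫ t in Ioi (0 : ℝ), gammaLower ((d : ℝ) / 2 + α) t *
          (t ^ (-((d : ℝ) / 2 + 1)) * powDefectLaplace ((d : ℝ) / 2 - s) s (‖ξ‖ ^ 2) t) := by
  have hd' : (2 : ℝ) ≤ d := by exact_mod_cast hd
  have ha : 1 ≤ (d : ℝ) / 2 + α := by linarith
  let f : EuclideanSpace ℝ (Fin d) → ℝ → ℝ := fun z t =>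
    gammaLower ((d : ℝ) / 2 + α) t * Real.exp (-t * ‖z‖ ^ 2) *
      (transverseForm ξ z * rieszDiff s ξ z)
  have hlap : ∀ z : EuclideanSpace ℝ (Fin d), z ≠ 0 →
      IntegrableOn (fun t => gammaLower ((d : ℝ) / 2 + α) t * Real.exp (-t * ‖z‖ ^ 2)) (Ioi 0) ∧
      ∫ t in Ioi (0 : ℝ), gammaLower ((d : ℝ) / 2 + α) t * Real.exp (-t * ‖z‖ ^ 2) =
        (1 + ‖z‖ ^ 2) ^ (-((d : ℝ) / 2 + α)) / ‖z‖ ^ 2 := by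
    intro z hz
    have h1 : 0 < ‖z‖ ^ 2 := by have := norm_pos_iff.2 hz; positivity
    exact ⟨integrableOn_gammaLower_mul_exp ha h1, integral_gammaLower_mul_exp ha h1⟩
  have hI := integrable_div_mul_transverseForm_mul_rieszDiff (ξ := ξ) (by omega) hα0 hs0 hs1
  have hfm : Measurable (Function.uncurry f) := by
    have h1 : Measurable fun p : EuclideanSpace ℝ (Fin d) × ℝ =>
        gammaLower ((d : ℝ) / 2 + α) p.2 :=
      (continuous_gammaLower ha).measurable.comp measurable_snd
    have h2 : Measurable fun p : EuclideanSpace ℝ (Fin d) × ℝ =>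
        transverseForm ξ p.1 * rieszDiff s ξ p.1 :=
      ((continuous_transverseForm ξ).measurable.mul measurable_rieszDiff).comp measurable_fst
    exact Measurable.mul (Measurable.mul h1 (by fun_prop)) h2
  have hfI : Integrable (Function.uncurry f) (volume.prod (volume.restrict (Ioi (0 : ℝ)))) := by
    refine (integrable_prod_iff hfm.aestronglyMeasurable).2 ⟨?_, ?_⟩
    · filter_upwards [ae_ne_zero (by omega) 0] with z hz
      exact (hlap z hz).1.mul_const (transverseForm ξ z * rieszDiff s ξ z)
    · refine hI.norm.congr ?_
      filter_upwards [ae_ne_zero (by omega) 0] with z hz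
      rw [norm_mul, Real.norm_of_nonneg (by positivity), ← (hlap z hz).2, ← integral_mul_const]
      refine setIntegral_congr_fun measurableSet_Ioi fun t ht => ?_
      have h3 := gammaLower_nonneg ha (le_of_lt ht)
      simp only [Function.uncurry, f]
      rw [norm_mul (_ * _), Real.norm_of_nonneg (by positivity : 0 ≤ _ * Real.exp _)]
  -- Fubini provides, for almost every t, the slice integrability that the Gaussian computation
  -- takes as a hypothesis.
  have hslice := hfI.prod_left_ae
  rw [← integral_sub_left_eq_self _ volume ξ, integral_congr_ae
    (g := fun z => ∫ t in Ioi (0 : ℝ), f z t), integral_integral_swap hfI, ← integral_const_mul]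
  · refine integral_congr_ae ?_
    filter_upwards [hslice, ae_restrict_mem measurableSet_Ioi] with t hti ht
    have hg := gammaLower_pos ha ht
    have h1 : ∀ z, f z t = gammaLower ((d : ℝ) / 2 + α) t *
        (transverseForm ξ z * Real.exp (-t * ‖z‖ ^ 2) * rieszDiff s ξ z) := fun z => by
      simp only [f]; ring
    simp only [Function.uncurry_apply_pair, h1] at hti
    have hti' : Integrable fun z : EuclideanSpace ℝ (Fin d) =>
        transverseForm ξ z * Real.exp (-t * ‖z‖ ^ 2) * rieszDiff s ξ z :=
      (integrable_const_mul_iff (isUnit_iff_ne_zero.2 hg.ne') _).1 hti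
    simp_rw [h1]
    rw [integral_const_mul, integral_transverseForm_mul_exp_mul_rieszDiff hd hξ hs0 hs1 ht hti']
    ring
  · filter_upwards [ae_ne_zero (by omega) 0] with z hz
    simp only [f]
    rw [fluxIntegrand_sub hz, integral_mul_const, (hlap z hz).2]

/-- The identity Γ(1-α) = -αΓ(-α) absorbs the minus sign, leaving a form whose positivity is
visible. -/
theorem fluxConstant_eq (hα0 : 0 < α) :
    fluxConstant d α s = (2 * Real.pi) ^ (-(d : ℝ) / 2) *
      (((d : ℝ) - 1) * Real.pi ^ ((d : ℝ) / 2) / (2 * Real.Gamma s)) *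
      (mellinConst α ((d : ℝ) / 2 - s) * Real.Gamma (s + α) /
        Real.Gamma ((d : ℝ) / 2 + α + 1)) := by
  have h1 : Real.Gamma (1 - α) = -α * Real.Gamma (-α) := by
    rw [← Real.Gamma_add_one (by linarith)]; ring_nf
  have h2 : (2 * Real.pi) ^ (-(d : ℝ) / 2) * Real.pi ^ ((d : ℝ) / 2) = (2 : ℝ) ^ (-(d : ℝ) / 2) := by
    rw [Real.mul_rpow two_pos.le Real.pi_pos.le, mul_assoc, ← Real.rpow_add Real.pi_pos,
      show -(d : ℝ) / 2 + (d : ℝ) / 2 = 0 by ring, Real.rpow_zero, mul_one]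
  have h3 : (2 : ℝ) ^ (-(d : ℝ) / 2 - 1) = (2 : ℝ) ^ (-(d : ℝ) / 2) / 2 :=
    Real.rpow_sub_one two_ne_zero _
  rw [fluxConstant, mellinConst, h1, h3, ← h2,
    show ((d : ℝ) + 2 * α + 2) / 2 = (d : ℝ) / 2 + α + 1 by ring,
    show ((d : ℝ) - 2 * s + 2) / 2 = (d : ℝ) / 2 - s + 1 by ring,
    show ((d : ℝ) - 2 * s + 2 - 2 * α) / 2 = (d : ℝ) / 2 - s + 1 - α by ring]
  rw [show -α * Real.Gamma (-α) * Real.Gamma ((d : ℝ) / 2 - s + 1) /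
    (α * Real.Gamma ((d : ℝ) / 2 - s + 1 - α)) = -Real.Gamma (-α) *
      Real.Gamma ((d : ℝ) / 2 - s + 1) / Real.Gamma ((d : ℝ) / 2 - s + 1 - α) by
      rw [neg_mul, neg_mul, neg_mul, mul_assoc, neg_div, mul_div_mul_left _ _ hα0.ne', neg_div]]
  simp only [div_eq_mul_inv, mul_inv]
  ring

end flux

/-! ### The asymptotic estimate -/

theorem proposition4p2 (d : ℕ) (hd : 2 ≤ d) (α s : ℝ) (hα0 : 0 < α) (hα1 : α < 1)
    (hs0 : 0 < s) (hs1 : s < (d : ℝ) / 2) :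
    (∀ ξ : EuclideanSpace ℝ (Fin d), ξ ≠ 0 →
      Integrable (fun η : EuclideanSpace ℝ (Fin d) => fluxIntegrand α s ξ η) volume) ∧
    0 < fluxConstant d α s ∧
    ∃ C : ℝ, 0 < C ∧ ∀ ξ : EuclideanSpace ℝ (Fin d), ξ ≠ 0 →
      |fluxFunction α s ξ + fluxConstant d α s * ‖ξ‖ ^ (2 - 2 * α - 2 * s)|
        ≤ C * ‖ξ‖ ^ (-(2 * s)) := by
  have hd' : (2 : ℝ) ≤ d := by exact_mod_cast hd
  have hπ := Real.pi_pos
  have hΓ1 : 0 < Real.Gamma s := Real.Gamma_pos_of_pos hs0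
  have hΓ2 : 0 < Real.Gamma (s + α) := Real.Gamma_pos_of_pos (by linarith)
  have hΓ3 : 0 < Real.Gamma ((d : ℝ) / 2 + α + 1) := Real.Gamma_pos_of_pos (by linarith)
  have hM := mellinConst_pos (b := (d : ℝ) / 2 - s) (by linarith) hα0 hα1
  have hd1 : 0 < (d : ℝ) - 1 := by linarith
  set c : ℝ := (2 * Real.pi) ^ (-(d : ℝ) / 2) *
      (((d : ℝ) - 1) * Real.pi ^ ((d : ℝ) / 2) / (2 * Real.Gamma s)) with hc
  have hc0 : 0 < c := by positivity
  have hK := fluxConstant_eq (d := d) (s := s) hα0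
  rw [← hc] at hK
  refine ⟨fun ξ _ => integrable_fluxIntegrand (by omega) hα0 hs0 hs1, by rw [hK]; positivity, ?_⟩
  obtain ⟨C, hC, hbound⟩ := exists_integral_gammaLower_mul_powDefectLaplace_bound
    (b := (d : ℝ) / 2 - s) (by linarith) hs0 hα0 hα1 (δ := (d : ℝ) / 2) (by linarith)
  refine ⟨c * C, by positivity, fun ξ hξ => ?_⟩
  have hn : 0 < ‖ξ‖ := norm_pos_iff.2 hξ
  have hb := hbound (‖ξ‖ ^ 2) (by positivity)
  rw [fluxFunction, integral_fluxIntegrand_eq hd hξ hα0 hs0 hs1, hK]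
  set E : ℝ := ∫ t in Ioi (0 : ℝ), gammaLower ((d : ℝ) / 2 + α) t *
          (t ^ (-((d : ℝ) / 2 + 1)) * powDefectLaplace ((d : ℝ) / 2 - s) s (‖ξ‖ ^ 2) t)
  have e1 : ‖ξ‖ ^ (2 - 2 * α - 2 * s) = ‖ξ‖ ^ 2 * (‖ξ‖ ^ 2) ^ (-(s + α)) := by
    rw [Real.sq_rpow_neg hn.le, ← Real.rpow_two, ← Real.rpow_add hn]; ring_nf
  have e2 : ‖ξ‖ ^ (-(2 * s)) = ‖ξ‖ ^ 2 * (‖ξ‖ ^ 2) ^ (-(s + 1)) := by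
    rw [Real.sq_rpow_neg hn.le, ← Real.rpow_two, ← Real.rpow_add hn]; ring_nf
  rw [e1, e2]
  calc _ = |(c * ‖ξ‖ ^ 2) * (mellinConst α ((d : ℝ) / 2 - s) * Real.Gamma (s + α) *
        (‖ξ‖ ^ 2) ^ (-(s + α)) / Real.Gamma ((d : ℝ) / 2 + α + 1) - E)| := by
        congr 1; rw [hc]; ring
    _ = (c * ‖ξ‖ ^ 2) * |mellinConst α ((d : ℝ) / 2 - s) * Real.Gamma (s + α) *
        (‖ξ‖ ^ 2) ^ (-(s + α)) / Real.Gamma ((d : ℝ) / 2 + α + 1) - E| := by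
        rw [abs_mul, abs_of_pos (by positivity : 0 < c * ‖ξ‖ ^ 2)]
    _ ≤ (c * ‖ξ‖ ^ 2) * (C * (‖ξ‖ ^ 2) ^ (-(s + 1))) := by gcongr
    _ = _ := by ring
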